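/- Let $f:\mathbb R^n\to\mathbb R^n$ and $g:\mathbb R^n\to\mathbb R^{n\times m}$ be (locally) Lipschitz, and consider $\dot x=f(x)+g(x)u$ with input constraint $u\in\Psi(x)=\{u\in\mathbb R^m:\mathfrak a_i(x)^\top u\le \mathfrak b_i(x),\ i=1,\dots,\mathfrak N\}$ and set-valued output $\Phi(x)=\{c\in\mathbb R^l: a_j(x)^\top c\le b_j(x),\ j=1,\dots,N\}$, where all $a_j,b_j,\mathfrak a_i,\mathfrak b_i$ are continuously differentiable, $\Psi(x)\neq\emptyset$ and $a_j(x)\ne0$ for all $x$ and $j$, and $\Phi(x)$ is contained in a fixed compact set for all $x$. Let $\mathcal A=\{x:\operatorname{Int}\Phi(x)\ne\emptyset\}$, fix $\epsilon_0>0$, let $q=(0,-1)\in\mathbb R^l\times\mathbb R$, $\tilde a_0=(0,-1)$, $\tilde b_0=0$, $\tilde a_j(x)=(a_j(x),\|a_j(x)\|)$, $\tilde b_j=b_j$ for $1\le j\le N$, $F_P(x)=\{z\in\mathbb R^{l+1}:\tilde a_j(x)^\top z\le\tilde b_j(x),\ 0\le j\le N\}$, and for $x\in\mathcal A$ put $$h_r(x)=-\epsilon_0-\min_{z\in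 F_P(x)}q^\top z,\qquad S(x)=\arg\min_{z\in F_P(x)}q^\top z .$$ Let $\mathcal S=\{x\in\mathcal A:h_r(x)\ge0\}$. For $z\in F_P(x)$ let $\mathcal J_0(z,x)=\{j:\tilde a_j(x)^\top z=\tilde b_j(x)\}$, $$M(z,x)=\Big\{\mu\in\mathbb R^{\mathcal J_0(z,x)}:\ \mu\ge0,\ \sum_{j\in\mathcal J_0(z,x)}\mu_j\tilde a_j(x)=-q\Big\},\qquad \partial_xL(\mu,z,x)=\sum_{j\in\mathcal J_0(z,x)}\mu_j\Big(z^\top\frac{\partial\tilde a_j}{\partial x}(x)-\frac{\partial\tilde b_j}{\partial x}(x)\Big).$$ Let $z^*(x)\in S(x)$ be any selection on $\mathcal A$, let $V_M(x)$ be the set of vertices (extreme points) of $M(z^*(x),x)$, and put $\Gamma(\mu,x,u)=-\partial_xL(\mu,z^*(x),x)\,(f(x)+g(x)u)$. For every $x\in\mathcal A$ the set $V_M(x)$ is finite and $M(z^*(x),x)=\operatorname{co}V_M(x)$. Suppose moreover that there exist $\alpha,\bar\epsilon>0$ such that for every $x\in\mathcal A$ with $h_r(x)\ge-\bar\epsilon$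 there is $u\in\Psi(x)$ with $$\Gamma(\mu,x,u)\ge-\alpha h_r(x)\qquad\text{for all }\mu\in V_M(x).$$ Then $h_r$ satisfies the nonsmooth control barrier condition on $\mathcal S$: all one-sided directional derivatives $h_r'(x;d)$, $x\in\mathcal A$, $d\in\mathbb R^n$, exist and are finite, and there are a continuous strictly increasing $\beta:\mathbb R\to\mathbb R$ with $\beta(0)=0$ and an open set $D$ with $\mathcal S\subseteq D\subseteq\mathcal A$ such that $\sup_{u\in\Psi(x)}h_r'(x;f(x)+g(x)u)\ge-\beta(h_r(x))$ for all $x\in D$. If in addition $\mathcal S$ is nonempty and has no isolated point, and $h_r$ has no zero in $\operatorname{Int}\mathcal S$, then $h_r$ is a nonsmooth control barrier function on $\mathcal S$: besides the condition above, $\mathcal S$ is closed, $h_r$ is locally Lipschitz on $\mathcal A$, $h_r=0$ on $\partial\mathcal S$, $h_r>0$ on $\operatorname{Int}\mathcal S$, and $h_r<0$ on $\mathcal A\setminus\mathcal S$. -/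

import Mathlib

open Set Filter Topology

noncomputable section

namespace PVM

/-- Column vectors of length `n`, with the Euclidean norm and inner product. -/
abbrev Vec (n : ℕ) := EuclideanSpace ℝ (Fin n)

/-! ### Nonsmooth control barrier functions -/

/-- Extended class-K functions. -/
def IsExtendedClassK (α : ℝ → ℝ) : Prop :=
  Continuous α ∧ StrictMono α ∧ α 0 = 0

/-- `ℓ` is the one-sided directional derivative of `h` at `x` along `d`. -/
def HasDirDeriv {n : ℕ} (h : Vec n → ℝ) (x d : Vec n) (ℓ : ℝ) : Prop :=
  Tendsto (fun σ : ℝ => (h (x + σ • d) - h x) / σ) (𝓝[>] 0) (𝓝 ℓ)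

/-- The one-sided directional derivative `h'(x; d)`; meaningful only where the limit exists, which
is required separately wherever this is used. -/
def dirDeriv {n : ℕ} (h : Vec n → ℝ) (x d : Vec n) : ℝ :=
  limUnder (𝓝[>] (0 : ℝ)) (fun σ : ℝ => (h (x + σ • d) - h x) / σ)

/-- `h` (a function whose domain is `dom`; `dom = univ` for a function on the whole space)
is a nonsmooth barrier function candidate on the nonempty closed set `C` without isolated points. -/
structure IsNBFCandidate {n : ℕ} (dom : Set (Vec n)) (h : Vec n → ℝ) (C : Set (Vec n)) : Prop where
  nonempty : C.Nonempty
  closed : IsClosed C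
  no_isolated : Preperfect C
  subset_dom : C ⊆ dom
  locLip : LocallyLipschitzOn dom h
  zero_frontier : ∀ x ∈ frontier C, h x = 0
  pos_interior : ∀ x ∈ interior C, 0 < h x
  neg_outside : ∀ x ∈ dom \ C, h x < 0

/-- The control barrier condition for `ẋ = f x + g x u`, `u ∈ U x`, and the function `h` with domain
`dom`: all directional derivatives of `h` exist and are finite on `dom`, and for some extended
class-K function `α` and some open set `D` with `C ⊆ D ⊆ dom`,
`sup_{u ∈ U x} h'(x; f x + g x u) ≥ -α (h x)` on `D`.
The supremum is taken in the extended reals, since `U x` may be unbounded. -/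
def NCBFCondition {n m : ℕ} (f : Vec n → Vec n) (g : Vec n → Vec m →L[ℝ] Vec n)
    (U : Vec n → Set (Vec m)) (dom : Set (Vec n)) (h : Vec n → ℝ) (C : Set (Vec n)) : Prop :=
  (∀ x ∈ dom, ∀ d : Vec n, ∃ ℓ : ℝ, HasDirDeriv h x d ℓ) ∧
  ∃ (α : ℝ → ℝ) (D : Set (Vec n)), IsExtendedClassK α ∧ IsOpen D ∧ C ⊆ D ∧ D ⊆ dom ∧
    ∀ x ∈ D, ((-(α (h x)) : ℝ) : EReal) ≤
      ⨆ u ∈ U x, ((dirDeriv h x (f x + g x u) : ℝ) : EReal)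

/-- `h`, with domain `dom`, is a nonsmooth control barrier function on `C` for the system
`ẋ = f x + g x u`, `u ∈ U x`. -/
def IsNCBF {n m : ℕ} (f : Vec n → Vec n) (g : Vec n → Vec m →L[ℝ] Vec n)
    (U : Vec n → Set (Vec m)) (dom : Set (Vec n)) (h : Vec n → ℝ) (C : Set (Vec n)) : Prop :=
  IsNBFCandidate dom h C ∧ NCBFCondition f g U dom h C

/-! ### State-dependent polytopes and the Chebyshev-ball linear program -/

/-- The state-dependent polyhedron `{c | a_j(x)ᵀ c ≤ b_j(x) for all j}`. -/
def polytope {n l N : ℕ} (a : Fin N → Vec n → Vec l) (b : Fin N → Vec n → ℝ) (x : Vec n) :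
    Set (Vec l) :=
  {c | ∀ j, inner ℝ (a j x) c ≤ b j x}

/-- The set of states at which the polytope has nonempty interior. -/
def setA {n l N : ℕ} (a : Fin N → Vec n → Vec l) (b : Fin N → Vec n → ℝ) : Set (Vec n) :=
  {x | (interior (polytope a b x)).Nonempty}

/-- `pᵀ z` for vectors of length `l + 1`, written as pairs `col(c, r)`. -/
def dot {l : ℕ} (p z : Vec l × ℝ) : ℝ := inner ℝ p.1 z.1 + p.2 * z.2

/-- The cost vector `q = col(0, -1)`. -/
def costVec (l : ℕ) : Vec l × ℝ := (0, -1)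

/-- The rows of the augmented constraint matrix: row `0` is `(0, -1)`, the row of index `j + 1` is
`(a_j(x), ‖a_j(x)‖)`. -/
def rowA {n l N : ℕ} (a : Fin N → Vec n → Vec l) (j : Fin (N + 1)) (x : Vec n) : Vec l × ℝ :=
  Fin.cases (motive := fun _ => Vec l × ℝ) (0, -1) (fun i => (a i x, ‖a i x‖)) j

/-- The entries of the augmented right-hand side: `0, b_1(x), …, b_N(x)`. -/
def rowB {n N : ℕ} (b : Fin N → Vec n → ℝ) (j : Fin (N + 1)) (x : Vec n) : ℝ :=
  Fin.cases (motive := fun _ => ℝ) 0 (fun i => b i x) j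

/-- The feasible set `F_P(x)` of the linear program. -/
def feasible {n l N : ℕ} (a : Fin N → Vec n → Vec l) (b : Fin N → Vec n → ℝ) (x : Vec n) :
    Set (Vec l × ℝ) :=
  {z | ∀ j, dot (rowA a j x) z ≤ rowB b j x}

/-- The Chebyshev radius `r*(x) = - min_{z ∈ F_P(x)} qᵀ z`. -/
def radius {n l N : ℕ} (a : Fin N → Vec n → Vec l) (b : Fin N → Vec n → ℝ) (x : Vec n) : ℝ :=
  - sInf (dot (costVec l) '' feasible a b x)

/-- `h_r(x) = r*(x) - ε₀`; only its values on `setA a b` are meaningful. -/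
def hr {n l N : ℕ} (a : Fin N → Vec n → Vec l) (b : Fin N → Vec n → ℝ) (ε₀ : ℝ) (x : Vec n) : ℝ :=
  radius a b x - ε₀

/-- `{x ∈ 𝒜 | h_r(x) ≥ -ε}`, as `h_r` has domain `𝒜`. -/
def superlevel {n l N : ℕ} (a : Fin N → Vec n → Vec l) (b : Fin N → Vec n → ℝ) (ε₀ ε : ℝ) :
    Set (Vec n) :=
  {x | x ∈ setA a b ∧ -ε ≤ hr a b ε₀ x}

/-- The safe set `𝒮 = {x ∈ 𝒜 | h_r(x) ≥ 0}`. -/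
def safeSet {n l N : ℕ} (a : Fin N → Vec n → Vec l) (b : Fin N → Vec n → ℝ) (ε₀ : ℝ) :
    Set (Vec n) :=
  {x | x ∈ setA a b ∧ 0 ≤ hr a b ε₀ x}

/-- The set `S(x)` of minimizers of the linear program. -/
def solutions {n l N : ℕ} (a : Fin N → Vec n → Vec l) (b : Fin N → Vec n → ℝ) (x : Vec n) :
    Set (Vec l × ℝ) :=
  {z | z ∈ feasible a b x ∧ ∀ w ∈ feasible a b x, dot (costVec l) z ≤ dot (costVec l) w}

open Classical in
/-- The active index set `J₀(z, x)`. -/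
def activeSet {n l N : ℕ} (a : Fin N → Vec n → Vec l) (b : Fin N → Vec n → ℝ)
    (z : Vec l × ℝ) (x : Vec n) : Finset (Fin (N + 1)) :=
  Finset.univ.filter (fun j => dot (rowA a j x) z = rowB b j x)

/-- The multiplier polytope `M(z, x)`, a set of vectors indexed by the active constraints. -/
def multipliers {n l N : ℕ} (a : Fin N → Vec n → Vec l) (b : Fin N → Vec n → ℝ)
    (z : Vec l × ℝ) (x : Vec n) : Set (activeSet a b z x → ℝ) :=
  {μ | ∑ j, μ j • rowA a (j : Fin (N + 1)) x = -costVec l ∧ ∀ j, 0 ≤ μ j}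

/-- The vertices of `M(z, x)`. -/
def vertices {n l N : ℕ} (a : Fin N → Vec n → Vec l) (b : Fin N → Vec n → ℝ)
    (z : Vec l × ℝ) (x : Vec n) : Set (activeSet a b z x → ℝ) :=
  (multipliers a b z x).extremePoints ℝ

/-- The partial derivative `∂ₓL(μ, z, x)` of the Lagrangian applied to a vector `v`, i.e.
`∑_{j ∈ J₀(z, x)} μ_j (zᵀ (∂ã_j/∂x)(x) v - (∂b̃_j/∂x)(x) v)`. -/
def lagrangianDx {n l N : ℕ} (a : Fin N → Vec n → Vec l) (b : Fin N → Vec n → ℝ)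
    (z : Vec l × ℝ) (x : Vec n) (μ : activeSet a b z x → ℝ) (v : Vec n) : ℝ :=
  ∑ j, μ j * (dot z (fderiv ℝ (rowA a (j : Fin (N + 1))) x v)
    - fderiv ℝ (rowB b (j : Fin (N + 1))) x v)

/-- `Γ(μ, x, u) = -∂ₓL(μ, z, x) (f(x) + g(x) u)`, with `z = z*(x)` as an argument. -/
def Gam {n m l N : ℕ} (a : Fin N → Vec n → Vec l) (b : Fin N → Vec n → ℝ)
    (f : Vec n → Vec n) (g : Vec n → Vec m →L[ℝ] Vec n)
    (z : Vec l × ℝ) (x : Vec n) (μ : activeSet a b z x → ℝ) (u : Vec m) : ℝ :=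
  - lagrangianDx a b z x μ (f x + g x u)

end PVM

end

/-! Everything rests on Slater's condition: where the polytope has interior, the linear program has
a strictly feasible point `zt`, which stays feasible with a margin at nearby states. Pulling an
almost feasible point towards `zt` repairs small violations, so the radius is locally Lipschitz
(`locallyLipschitzOn_radius`). The same correction turns difference quotients of nearby solutions
into strictly feasible directions of the linearized program. Each such direction bounds all later
quotients of the radius from below, so the quotients cannot oscillate and the directional derivative
exists (`exists_hasDirDeriv_radius`).

For the barrier inequality only the lower half of the sensitivity formula is needed, at the single
solution `z*(x)`. By a theorem of alternatives, either some linearized direction increases the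
radius faster than a prescribed rate, or a multiplier certifies that none does
(`le_of_hasDirDeriv_radius`). Slater's condition also makes the multiplier set compact. As a
polytope it is the hull of its vertices, so a bound on the Lagrangian derivative at the vertices
holds at every multiplier. -/

namespace PVM

/-! ### The bilinear pairing on `Vec l × ℝ` -/

section dot

variable {l : ℕ}

theorem continuous_dot : Continuous fun p : (Vec l × ℝ) × (Vec l × ℝ) => dot p.1 p.2 := by
  unfold dot
  fun_prop

theorem dot_add_right (p z w : Vec l × ℝ) : dot p (z + w) = dot p z + dot p w := by
  simp only [dot, Prod.fst_add, Prod.snd_add, inner_add_right]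
  ring

theorem dot_sub_right (p z w : Vec l × ℝ) : dot p (z - w) = dot p z - dot p w := by
  simp only [dot, Prod.fst_sub, Prod.snd_sub, inner_sub_right]
  ring

theorem dot_smul_right (p : Vec l × ℝ) (t : ℝ) (z : Vec l × ℝ) :
    dot p (t • z) = t * dot p z := by
  simp only [dot, Prod.smul_fst, Prod.smul_snd, inner_smul_right, smul_eq_mul]
  ring

theorem dot_add_left (p q z : Vec l × ℝ) : dot (p + q) z = dot p z + dot q z := by
  simp only [dot, Prod.fst_add, Prod.snd_add, inner_add_left]
  ring

theorem dot_sub_left (p q z : Vec l × ℝ) : dot (p - q) z = dot p z - dot q z := by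
  simp only [dot, Prod.fst_sub, Prod.snd_sub, inner_sub_left]
  ring

theorem dot_smul_left (t : ℝ) (p z : Vec l × ℝ) : dot (t • p) z = t * dot p z := by
  simp only [dot, Prod.smul_fst, Prod.smul_snd, real_inner_smul_left, smul_eq_mul]
  ring

theorem dot_zero_left (z : Vec l × ℝ) : dot 0 z = 0 := by
  simp [dot]

theorem dot_sum_left {ι : Type*} (s : Finset ι) (p : ι → Vec l × ℝ) (z : Vec l × ℝ) :
    dot (∑ i ∈ s, p i) z = ∑ i ∈ s, dot (p i) z := by
  classical
  induction s using Finset.induction_on with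
  | empty => simp [dot_zero_left]
  | insert i s hi ih => rw [Finset.sum_insert hi, Finset.sum_insert hi, dot_add_left, ih]

theorem dot_costVec (z : Vec l × ℝ) : dot (costVec l) z = -z.2 := by
  simp [dot, costVec]

theorem dot_neg_costVec (z : Vec l × ℝ) : dot (-costVec l) z = z.2 := by
  simp [dot, costVec]

theorem eq_zero_of_dot_eq_zero {p : Vec l × ℝ} (h : ∀ z, dot p z = 0) : p = 0 := by
  have h1 := h p
  simp only [dot, real_inner_self_eq_norm_sq] at h1
  have h2 : ‖p.1‖ ^ 2 = 0 := by nlinarith [sq_nonneg ‖p.1‖, mul_self_nonneg p.2]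
  have h3 : p.2 * p.2 = 0 := by nlinarith [sq_nonneg ‖p.1‖, mul_self_nonneg p.2]
  ext1
  · simpa using h2
  · simpa using h3

theorem abs_dot_le (p z : Vec l × ℝ) : |dot p z| ≤ 2 * (‖p‖ * ‖z‖) := by
  have h1 : |inner ℝ p.1 z.1| ≤ ‖p‖ * ‖z‖ :=
    (abs_real_inner_le_norm _ _).trans
      (mul_le_mul (norm_fst_le p) (norm_fst_le z) (norm_nonneg _) (norm_nonneg _))
  have h2 : |p.2 * z.2| ≤ ‖p‖ * ‖z‖ := by
    rw [abs_mul]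
    exact mul_le_mul (norm_snd_le p) (norm_snd_le z) (abs_nonneg _) (norm_nonneg _)
  calc |dot p z| ≤ |inner ℝ p.1 z.1| + |p.2 * z.2| := abs_add_le _ _
    _ ≤ _ := by linarith

theorem hasDerivAt_dot {p z : ℝ → Vec l × ℝ} {p' z' : Vec l × ℝ} {t : ℝ}
    (hp : HasDerivAt p p' t) (hz : HasDerivAt z z' t) :
    HasDerivAt (fun s => dot (p s) (z s)) (dot (p t) z' + dot p' (z t)) t := by
  have hp1 : HasDerivAt (fun s => (p s).1) p'.1 t := hp.fst
  have hp2 : HasDerivAt (fun s => (p s).2) p'.2 t := hp.snd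
  have hz1 : HasDerivAt (fun s => (z s).1) z'.1 t := hz.fst
  have hz2 : HasDerivAt (fun s => (z s).2) z'.2 t := hz.snd
  have h := (hp1.inner ℝ hz1).add (hp2.mul hz2)
  refine h.congr_deriv ?_
  simp only [dot]
  ring

end dot

/-! ### A theorem of alternatives and extreme points of polyhedra -/

section multipliers

variable {ι V : Type*} [Fintype ι] [AddCommGroup V] [Module ℝ V]

/-- Finitely many affine functions are simultaneously negative somewhere, unless a nontrivial
nonnegative combination of them is nonnegative everywhere. -/
theorem exists_forall_neg_or_exists_nonneg_combination (ℓ : ι → V →ₗ[ℝ] ℝ) (c : ι → ℝ) :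
    (∃ w, ∀ i, ℓ i w + c i < 0) ∨
      ∃ lam : ι → ℝ, (∀ i, 0 ≤ lam i) ∧ (∃ i, lam i ≠ 0) ∧
        ∀ w, 0 ≤ ∑ i, lam i * (ℓ i w + c i) := by
  classical
  by_cases hex : ∃ w, ∀ i, ℓ i w + c i < 0
  · exact Or.inl hex
  right
  -- The negative orthant `O` misses the affine image `C`. The coordinates of a separating
  -- functional `φ` are the weights sought.
  set O : Set (ι → ℝ) := univ.pi fun _ => Iio 0 with hO
  set C : Set (ι → ℝ) := range fun w i => ℓ i w + c i with hC
  have hOc : Convex ℝ O := convex_pi fun _ _ => convex_Iio 0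
  have hOo : IsOpen O := isOpen_set_pi finite_univ fun _ _ => isOpen_Iio
  have hCc : Convex ℝ C := by
    rintro _ ⟨w, rfl⟩ _ ⟨w', rfl⟩ s t _ _ hst
    refine ⟨s • w + t • w', ?_⟩
    ext i
    simp only [map_add, map_smul, Pi.add_apply, Pi.smul_apply, smul_eq_mul]
    linear_combination (-(c i)) * hst
  have hdisj : Disjoint O C := by
    rw [Set.disjoint_left]
    rintro y hy ⟨w, rfl⟩
    exact hex ⟨w, fun i => hy i (mem_univ i)⟩
  obtain ⟨φ, u, hφO, hφC⟩ := geometric_hahn_banach_open hOc hOo hCc hdisj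
  have hle : ∀ ⦃y⦄, y ∈ closure O → φ y ≤ u := fun y hy =>
    (closure_minimal (t := {y | φ y ≤ u}) (fun y hy => (hφO y hy).le)
      (isClosed_le φ.continuous continuous_const)) hy
  have hu : 0 ≤ u := by
    have hcl : (0 : ι → ℝ) ∈ closure O := by
      rw [hO, closure_pi_set]
      intro i _
      simp
    simpa using hle hcl
  have hφ : ∀ y, φ y = ∑ i, φ (Pi.single i 1) * y i := by
    intro y
    conv_lhs => rw [pi_eq_sum_univ' y]
    rw [map_sum]
    refine Finset.sum_congr rfl fun i _ => ?_
    rw [map_smul, smul_eq_mul, mul_comm]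
  refine ⟨fun i => φ (Pi.single i 1), fun i => ?_, ?_, fun w => ?_⟩
  -- With a negative weight, `φ` would be unbounded above on the ray `-t e_i` in the closure of `O`.
  · by_contra! hneg
    obtain ⟨t, ht0, ht⟩ : ∃ t : ℝ, 0 ≤ t ∧ u < -(t * φ (Pi.single i 1)) := by
      refine ⟨(u + 1) / -φ (Pi.single i 1), by apply div_nonneg <;> linarith, ?_⟩
      rw [div_neg, neg_mul, neg_neg, div_mul_cancel₀ _ hneg.ne]
      linarith
    have hcl : -(t • Pi.single i (1 : ℝ)) ∈ closure O := by
      rw [hO, closure_pi_set]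
      intro j _
      by_cases hj : j = i
      · subst hj
        simpa using ht0
      · simp [hj]
    have := hle hcl
    simp only [map_neg, map_smul, smul_eq_mul] at this
    linarith
  -- The separation is strict on the open side, so `φ` cannot vanish.
  · by_contra! hall
    have h1 := hφO (fun _ => -1) (fun i _ => by simp)
    have h2 := hφC _ ⟨0, rfl⟩
    rw [hφ] at h1 h2
    simp only [hall, zero_mul, Finset.sum_const_zero] at h1 h2
    linarith
  · have := hφC _ ⟨w, rfl⟩
    rw [hφ] at this
    exact hu.trans this

/-- A standard-form polyhedron `{μ ≥ 0, ∑ μ_j v_j = p}` has finitely many extreme points. -/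
theorem finite_extremePoints_nonneg_combinations (v : ι → V) (p : V) :
    ({μ : ι → ℝ | ∑ j, μ j • v j = p ∧ ∀ j, 0 ≤ μ j}.extremePoints ℝ).Finite := by
  set M := {μ : ι → ℝ | ∑ j, μ j • v j = p ∧ ∀ j, 0 ≤ μ j}
  -- An extreme point is determined by its support: if `μ` and `ν` share one, `μ ± t (μ - ν)` stays
  -- nonnegative for small `t`, and extremality of `μ` forces `μ = ν`.
  refine Set.Finite.of_finite_image (f := fun μ => {j | μ j ≠ 0}) (toFinite _) ?_
  intro μ hμ ν hν hsupp
  have hμM : ∑ j, μ j • v j = p ∧ ∀ j, 0 ≤ μ j := hμ.1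
  have hνM : ∑ j, ν j • v j = p ∧ ∀ j, 0 ≤ ν j := hν.1
  have hsmall : ∀ᶠ t : ℝ in 𝓝 0, ∀ j, 0 ≤ μ j + t * (μ j - ν j) := by
    refine eventually_all.2 fun j => ?_
    by_cases hj : μ j = 0
    · have : ν j = 0 := by
        by_contra h
        have hmem : j ∈ {j | ν j ≠ 0} := h
        have heq : {j | μ j ≠ 0} = {j | ν j ≠ 0} := hsupp
        rw [← heq] at hmem
        exact hmem hj
      simp [hj, this]
    · have hpos : 0 < μ j + 0 * (μ j - ν j) := by
        simpa using lt_of_le_of_ne (hμM.2 j) (Ne.symm hj)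
      have hc : ContinuousAt (fun t : ℝ => μ j + t * (μ j - ν j)) 0 := by fun_prop
      exact (hc.eventually (lt_mem_nhds hpos)).mono fun _ h => h.le
  have hsmall' : ∀ᶠ t : ℝ in 𝓝 0, ∀ j, 0 ≤ μ j + -t * (μ j - ν j) := by
    have : Tendsto (fun t : ℝ => -t) (𝓝 0) (𝓝 0) := by
      simpa using (continuous_neg (G := ℝ)).tendsto 0
    exact this.eventually hsmall
  obtain ⟨t, ⟨ht1, ht2⟩, ht0⟩ :=
    (((hsmall.and hsmall').filter_mono nhdsWithin_le_nhds).and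
      (self_mem_nhdsWithin (a := (0 : ℝ)) (s := Ioi 0))).exists
  have ht0 : 0 < t := ht0
  have hmem : ∀ s : ℝ, (∀ j, 0 ≤ μ j + s * (μ j - ν j)) → (μ + s • (μ - ν)) ∈ M := by
    intro s hs
    refine ⟨?_, fun j => by simpa using hs j⟩
    simp only [Pi.add_apply, Pi.smul_apply, Pi.sub_apply, smul_eq_mul, add_smul, mul_smul, sub_smul,
      Finset.sum_add_distrib, ← Finset.smul_sum, Finset.sum_sub_distrib, hμM.1, hνM.1, sub_self,
      smul_zero, add_zero]
  have hseg : μ ∈ openSegment ℝ (μ + t • (μ - ν)) (μ + (-t) • (μ - ν)) := by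
    refine ⟨1 / 2, 1 / 2, by norm_num, by norm_num, by norm_num, ?_⟩
    module
  have heq := hμ.2 (hmem t ht1) (hmem (-t) ht2) hseg
  have hz : t • (μ - ν) = 0 := by simpa using heq
  rcases smul_eq_zero.1 hz with h | h
  · exact absurd h ht0.ne'
  · exact sub_eq_zero.1 h

end multipliers

/-! ### Feasibility, compactness and Lipschitz dependence of the linear program -/

section program

variable {n l N : ℕ} {a : Fin N → Vec n → Vec l} {b : Fin N → Vec n → ℝ}

theorem contDiff_rowA (ha : ∀ j, ContDiff ℝ 1 (a j)) (ha0 : ∀ j x, a j x ≠ 0)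
    (j : Fin (N + 1)) : ContDiff ℝ 1 (rowA a j) := by
  refine Fin.cases ?_ (fun i => ?_) j
  · exact contDiff_const
  · exact (ha i).prodMk ((ha i).norm ℝ (ha0 i))

theorem contDiff_rowB (hb : ∀ j, ContDiff ℝ 1 (b j)) (j : Fin (N + 1)) :
    ContDiff ℝ 1 (rowB b j) := by
  refine Fin.cases ?_ (fun i => ?_) j
  · exact contDiff_const
  · exact hb i

theorem snd_nonneg_of_mem_feasible {x : Vec n} {z : Vec l × ℝ} (hz : z ∈ feasible a b x) :
    0 ≤ z.2 := by
  have := hz 0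
  simpa [dot, rowA, rowB] using this

/-- Cauchy–Schwarz: the entry `‖a_j‖` of each row pays for the worst displacement of length `z.2`,
so a feasible point is an inscribed ball. -/
theorem add_smul_mem_polytope {x : Vec n} {z : Vec l × ℝ} (hz : z ∈ feasible a b x)
    {e : Vec l} (he : ‖e‖ ≤ z.2) : z.1 + e ∈ polytope a b x := by
  intro j
  have h1 : inner ℝ (a j x) z.1 + ‖a j x‖ * z.2 ≤ b j x := hz j.succ
  have h2 : inner ℝ (a j x) e ≤ ‖a j x‖ * z.2 :=
    (real_inner_le_norm _ _).trans (mul_le_mul_of_nonneg_left he (norm_nonneg _))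
  rw [inner_add_right]
  linarith

theorem mem_setA_of_mem_feasible {x : Vec n} {z : Vec l × ℝ} (hz : z ∈ feasible a b x)
    (hpos : 0 < z.2) : x ∈ setA a b := by
  refine ⟨z.1, mem_interior.2 ⟨Metric.ball z.1 z.2, fun c hc => ?_, Metric.isOpen_ball,
    Metric.mem_ball_self hpos⟩⟩
  have := add_smul_mem_polytope hz (e := c - z.1)
    (by rw [← dist_eq_norm]; exact (Metric.mem_ball.1 hc).le)
  simpa using this

/-- At a state where the polytope has interior, the program has a strictly feasible point. -/
theorem exists_strictly_feasible (ha0 : ∀ j x, a j x ≠ 0) {x : Vec n} (hx : x ∈ setA a b) :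
    ∃ z, ∀ j, dot (rowA a j x) z < rowB b j x := by
  obtain ⟨c, hc⟩ := hx
  obtain ⟨r, hr, hball⟩ := Metric.isOpen_iff.1 isOpen_interior c hc
  -- Testing the polytope at distance `r / 2` from `c` along each `a_i` leaves a margin for the ball
  -- of radius `r / 4`.
  refine ⟨(c, r / 4), fun j => ?_⟩
  refine Fin.cases ?_ (fun i => ?_) j
  · simpa [dot, rowA, rowB] using hr
  · change inner ℝ (a i x) c + ‖a i x‖ * (r / 4) < b i x
    have hn : 0 < ‖a i x‖ := norm_pos_iff.2 (ha0 i x)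
    have hmem : c + (r / 2 / ‖a i x‖) • a i x ∈ polytope a b x := by
      refine interior_subset (hball ?_)
      rw [Metric.mem_ball, dist_eq_norm, add_sub_cancel_left, norm_smul, Real.norm_eq_abs,
        abs_of_pos (by positivity), div_mul_cancel₀ _ hn.ne']
      linarith
    have h := hmem i
    rw [inner_add_right, inner_smul_right, real_inner_self_eq_norm_sq] at h
    have h2 : r / 2 / ‖a i x‖ * ‖a i x‖ ^ 2 = ‖a i x‖ * (r / 2) := by field_simp
    rw [h2] at h
    nlinarith

theorem mem_setA_of_strictly_feasible {x : Vec n} {z : Vec l × ℝ}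
    (hz : ∀ j, dot (rowA a j x) z < rowB b j x) : x ∈ setA a b := by
  refine mem_setA_of_mem_feasible (z := z) (fun j => (hz j).le) ?_
  have := hz 0
  simpa [dot, rowA, rowB] using this

theorem continuous_slack (ha : ∀ j, ContDiff ℝ 1 (a j)) (ha0 : ∀ j x, a j x ≠ 0)
    (hb : ∀ j, ContDiff ℝ 1 (b j)) (j : Fin (N + 1)) :
    Continuous fun p : Vec n × (Vec l × ℝ) => dot (rowA a j p.1) p.2 - rowB b j p.1 :=
  (continuous_dot.comp (((contDiff_rowA ha ha0 j).continuous.comp continuous_fst).prodMk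
    continuous_snd)).sub ((contDiff_rowB hb j).continuous.comp continuous_fst)

theorem isOpen_setA (ha : ∀ j, ContDiff ℝ 1 (a j)) (ha0 : ∀ j x, a j x ≠ 0)
    (hb : ∀ j, ContDiff ℝ 1 (b j)) : IsOpen (setA a b) := by
  rw [isOpen_iff_mem_nhds]
  intro x hx
  obtain ⟨z, hz⟩ := exists_strictly_feasible ha0 hx
  have : ∀ᶠ y in 𝓝 x, ∀ j, dot (rowA a j y) z - rowB b j y < 0 :=
    eventually_all.2 fun j =>
      (((continuous_slack ha ha0 hb j).comp (continuous_id.prodMk continuous_const)).tendsto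
        x).eventually (gt_mem_nhds (sub_neg.2 (hz j)))
  exact this.mono fun y hy => mem_setA_of_strictly_feasible fun j => sub_neg.1 (hy j)

theorem mem_feasible_of_tendsto (ha : ∀ j, ContDiff ℝ 1 (a j)) (ha0 : ∀ j x, a j x ≠ 0)
    (hb : ∀ j, ContDiff ℝ 1 (b j)) {X : Type*} {F : Filter X} [F.NeBot] {y : X → Vec n}
    {z : X → Vec l × ℝ} {x₀ : Vec n} {z₀ : Vec l × ℝ} (hy : Tendsto y F (𝓝 x₀))
    (hz : Tendsto z F (𝓝 z₀)) (hfeas : ∀ᶠ i in F, z i ∈ feasible a b (y i)) :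
    z₀ ∈ feasible a b x₀ := by
  intro j
  have ht := ((continuous_slack ha ha0 hb j).tendsto (x₀, z₀)).comp (hy.prodMk_nhds hz)
  exact sub_nonpos.1 (le_of_tendsto ht (hfeas.mono fun i hi => sub_nonpos.2 (hi j)))

theorem radius_eq {x : Vec n} {z : Vec l × ℝ} (hz : z ∈ solutions a b x) :
    radius a b x = z.2 := by
  have : IsLeast (dot (costVec l) '' feasible a b x) (dot (costVec l) z) :=
    ⟨⟨z, hz.1, rfl⟩, by rintro _ ⟨w, hw, rfl⟩; exact hz.2 w hw⟩
  rw [radius, this.csInf_eq, dot_costVec, neg_neg]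

theorem snd_le_radius {x : Vec n} {z w : Vec l × ℝ} (hz : z ∈ solutions a b x)
    (hw : w ∈ feasible a b x) : w.2 ≤ radius a b x := by
  have := hz.2 w hw
  rw [dot_costVec, dot_costVec] at this
  rw [radius_eq hz]
  linarith

/-- Without constraints the radius could be increased forever. A genuine row is needed later to
supply a nonzero vector of `Vec l`. -/
theorem pos_of_mem_solutions {x : Vec n} {z : Vec l × ℝ} (hz : z ∈ solutions a b x) : 0 < N := by
  rcases Nat.eq_zero_or_pos N with rfl | h
  · exfalso
    have hf : z + (0, 1) ∈ feasible a b x := by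
      intro j
      refine Fin.cases ?_ (fun i => i.elim0) j
      have := snd_nonneg_of_mem_feasible hz.1
      simp only [dot, rowA, rowB, Fin.cases_zero, inner_zero_left, Prod.snd_add]
      linarith
    have := snd_le_radius hz hf
    rw [radius_eq hz, Prod.snd_add] at this
    linarith
  · exact h

theorem pos_of_solutions_nonempty (hsol : ∀ x ∈ setA a b, (solutions a b x).Nonempty) :
    0 < N := by
  rcases Nat.eq_zero_or_pos N with rfl | h
  · have huniv : polytope a b 0 = univ := eq_univ_of_forall fun c j => j.elim0
    obtain ⟨z, hz⟩ := hsol 0 ⟨0, by rw [huniv, interior_univ]; trivial⟩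
    exact pos_of_mem_solutions hz
  · exact h

/-- Feasible points lie in a compact set that does not depend on the state. -/
theorem exists_bound_of_mem_feasible (ha0 : ∀ j x, a j x ≠ 0)
    (hΦ : ∃ Dy : Set (Vec l), IsCompact Dy ∧ ∀ x, polytope a b x ⊆ Dy) (hN : 0 < N) :
    ∃ R : ℝ, ∀ x, ∀ z ∈ feasible a b x, ‖z‖ ≤ R := by
  obtain ⟨Dy, hDy, hsub⟩ := hΦ
  obtain ⟨C, hC⟩ := hDy.isBounded.exists_norm_le
  refine ⟨2 * C, fun x z hz => ?_⟩
  have hr := snd_nonneg_of_mem_feasible hz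
  have h0 : ‖z.1‖ ≤ C :=
    hC _ (hsub x (by simpa using add_smul_mem_polytope hz (e := 0) (by simpa using hr)))
  have hn := ha0 ⟨0, hN⟩ x
  set v := a ⟨0, hN⟩ x
  -- The center and a boundary point of the inscribed ball both lie in the compact set, which bounds
  -- the radius by twice its norm bound.
  have he : ‖(z.2 / ‖v‖) • v‖ = z.2 := by
    rw [norm_smul, Real.norm_eq_abs, abs_of_nonneg (by positivity),
      div_mul_cancel₀ _ (norm_ne_zero_iff.2 hn)]
  have h1 : ‖z.1 + (z.2 / ‖v‖) • v‖ ≤ C := hC _ (hsub x (add_smul_mem_polytope hz he.le))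
  have h2 : z.2 ≤ 2 * C := by
    calc z.2 = ‖(z.1 + (z.2 / ‖v‖) • v) - z.1‖ := by rw [add_sub_cancel_left, he]
      _ ≤ _ := norm_sub_le _ _
      _ ≤ 2 * C := by linarith
  rw [Prod.norm_def, Real.norm_eq_abs, abs_of_nonneg hr]
  exact max_le (by linarith [norm_nonneg z.1]) h2

/-- The Chebyshev radius is locally Lipschitz where the polytope has interior. -/
theorem locallyLipschitzOn_radius (ha : ∀ j, ContDiff ℝ 1 (a j)) (ha0 : ∀ j x, a j x ≠ 0)
    (hb : ∀ j, ContDiff ℝ 1 (b j)) {R : ℝ} (hR : ∀ x, ∀ z ∈ feasible a b x, ‖z‖ ≤ R)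
    (hsol : ∀ x ∈ setA a b, (solutions a b x).Nonempty) :
    LocallyLipschitzOn (setA a b) (radius a b) := by
  intro x hx
  obtain ⟨zt, hzt⟩ := exists_strictly_feasible ha0 hx
  have hR0 : 0 ≤ R := (norm_nonneg _).trans (hR x zt fun j => (hzt j).le)
  have hzt0 : 0 < zt.2 := by simpa [dot, rowA, rowB] using hzt 0
  obtain ⟨ρ, hρ, hρ0⟩ : ∃ ρ : ℝ, (∀ j, dot (rowA a j x) zt - rowB b j x + ρ < 0) ∧ 0 < ρ := by
    have : ∀ᶠ ρ : ℝ in 𝓝 0, ∀ j, dot (rowA a j x) zt - rowB b j x + ρ < 0 :=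
      eventually_all.2 fun j =>
        ((continuous_const.add continuous_id).tendsto (0 : ℝ)).eventually
          (gt_mem_nhds (by simpa using hzt j))
    exact ((this.filter_mono nhdsWithin_le_nhds).and
      (self_mem_nhdsWithin (a := (0 : ℝ)) (s := Ioi 0))).exists
  have hslack : ∀ᶠ y in 𝓝 x, ∀ j, dot (rowA a j y) zt - rowB b j y + ρ < 0 :=
    eventually_all.2 fun j =>
      ((((continuous_slack ha ha0 hb j).comp (continuous_id.prodMk continuous_const)).add
        continuous_const).tendsto x).eventually (gt_mem_nhds (hρ j))
  choose KA tA htA hKA using fun j => (contDiff_rowA ha ha0 j).locallyLipschitz x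
  choose KB tB htB hKB using fun j => (contDiff_rowB hb j).locallyLipschitz x
  -- A common Lipschitz constant for all constraint slacks at points of norm at most `R`; the factor
  -- 2 is that of `abs_dot_le`.
  set K : NNReal := ∑ j, (2 * KA j * R.toNNReal + KB j) with hK
  have hKj : ∀ j, 2 * (KA j : ℝ) * R + KB j ≤ K := by
    intro j
    have h := Finset.single_le_sum (f := fun j => 2 * KA j * R.toNNReal + KB j)
      (fun i _ => zero_le) (Finset.mem_univ j)
    have h' := NNReal.coe_le_coe.2 h
    push_cast [Real.coe_toNNReal R hR0] at h'
    rw [hK]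
    push_cast [Real.coe_toNNReal R hR0]
    exact h'
  set U : Set (Vec n) := setA a b ∩ ({y | ∀ j, dot (rowA a j y) zt - rowB b j y + ρ < 0} ∩
    ((⋂ j, tA j) ∩ ⋂ j, tB j)) with hU
  have hUmem : U ∈ 𝓝[setA a b] x :=
    inter_mem self_mem_nhdsWithin (mem_nhdsWithin_of_mem_nhds (inter_mem hslack
      (inter_mem (iInter_mem.2 htA) (iInter_mem.2 htB))))
  refine ⟨R.toNNReal * K / ρ.toNNReal, U, hUmem, LipschitzOnWith.of_le_add_mul _ ?_⟩
  intro y ⟨hyA, _, hyt, hyB⟩ y' ⟨hyA', hys, hyt', hyB'⟩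
  rw [mem_iInter] at hyt hyB hyt' hyB'
  obtain ⟨z, hz⟩ := hsol y hyA
  obtain ⟨z', hz'⟩ := hsol y' hyA'
  push_cast [Real.coe_toNNReal R hR0, Real.coe_toNNReal ρ hρ0.le]
  set κ : ℝ := K * dist y y' with hκ
  have hκ0 : 0 ≤ κ := by positivity
  have hstep : ∀ j, dot (rowA a j y') z - rowB b j y' ≤ κ := by
    intro j
    have h1 := hz.1 j
    have h2 : ‖rowA a j y' - rowA a j y‖ ≤ KA j * dist y y' := by
      rw [← dist_eq_norm, dist_comm]
      exact (hKA j).dist_le_mul y (hyt j) y' (hyt' j)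
    have h3 : |rowB b j y - rowB b j y'| ≤ KB j * dist y y' :=
      (hKB j).dist_le_mul y (hyB j) y' (hyB' j)
    have h4 := (le_abs_self _).trans (abs_dot_le (rowA a j y' - rowA a j y) z)
    have h5 : ‖rowA a j y' - rowA a j y‖ * ‖z‖ ≤ KA j * dist y y' * R :=
      mul_le_mul h2 (hR _ _ hz.1) (norm_nonneg _) (by positivity)
    have h6 := mul_le_mul_of_nonneg_right (hKj j) (dist_nonneg (x := y) (y := y'))
    rw [dot_sub_left] at h4
    have h7 := le_abs_self (rowB b j y - rowB b j y')
    nlinarith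
  -- At `y'`, the solution `z` violates constraints by at most `κ` while `zt` has margin `ρ`. This
  -- `t` solves `(1 - t) κ = t ρ`, so the convex combination is feasible.
  set t : ℝ := κ / (ρ + κ) with ht
  have hden : 0 < ρ + κ := by linarith
  have ht0 : 0 ≤ t := by positivity
  have htκ : t * (ρ + κ) = κ := div_mul_cancel₀ _ hden.ne'
  have ht1 : t ≤ 1 := by
    rw [ht, div_le_one hden]
    linarith
  have hfeas : z + t • (zt - z) ∈ feasible a b y' := by
    intro j
    have h1 := hstep j
    have h2 := (hys j).le
    rw [dot_add_right, dot_smul_right, dot_sub_right]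
    have h3 := mul_le_mul_of_nonneg_left h1 (sub_nonneg.2 ht1)
    have h4 := mul_le_mul_of_nonneg_left h2 ht0
    nlinarith
  have hle := snd_le_radius hz' hfeas
  rw [radius_eq hz]
  have hzR : z.2 ≤ R := (le_abs_self _).trans ((norm_snd_le z).trans (hR _ _ hz.1))
  simp only [Prod.snd_add, Prod.smul_snd, Prod.snd_sub, smul_eq_mul] at hle
  have htle : t ≤ κ / ρ := div_le_div_of_nonneg_left hκ0 hρ0 (by linarith)
  have h8 : t * z.2 ≤ κ / ρ * R :=
    mul_le_mul htle hzR (snd_nonneg_of_mem_feasible hz.1) (by positivity)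
  have h9 : R * K / ρ * dist y y' = κ / ρ * R := by
    rw [hκ]
    ring
  rw [h9]
  nlinarith [mul_nonneg ht0 hzt0.le]

end program

/-! ### Directional derivatives of the Chebyshev radius -/

section directional

variable {n l N : ℕ} {a : Fin N → Vec n → Vec l} {b : Fin N → Vec n → ℝ}

theorem dot_comm (p z : Vec l × ℝ) : dot p z = dot z p := by
  simp only [dot, real_inner_comm, mul_comm]

theorem hasDerivAt_comp_line {E : Type*} [NormedAddCommGroup E] [NormedSpace ℝ E]
    {F : Vec n → E} (hF : ContDiff ℝ 1 F) (x d : Vec n) :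
    HasDerivAt (fun σ : ℝ => F (x + σ • d)) (fderiv ℝ F x d) 0 :=
  (hF.differentiable one_ne_zero x).hasFDerivAt.hasLineDerivAt d

/-- The linearized constraint slack at an active constraint. -/
noncomputable def slackSlope (a : Fin N → Vec n → Vec l) (b : Fin N → Vec n → ℝ) (x d : Vec n)
    (z : Vec l × ℝ) (j : Fin (N + 1)) : ℝ :=
  dot z (fderiv ℝ (rowA a j) x d) - fderiv ℝ (rowB b j) x d

/-- A direction satisfying the linearized active constraints strictly is feasible along the
line `x + σ d`. -/
theorem eventually_mem_feasible (ha : ∀ j, ContDiff ℝ 1 (a j)) (ha0 : ∀ j x, a j x ≠ 0)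
    (hb : ∀ j, ContDiff ℝ 1 (b j)) {x d : Vec n} {z w : Vec l × ℝ} (hz : z ∈ feasible a b x)
    (hw : ∀ j, dot (rowA a j x) z = rowB b j x →
      dot (rowA a j x) w + slackSlope a b x d z j < 0) :
    ∀ᶠ σ : ℝ in 𝓝[>] 0, z + σ • w ∈ feasible a b (x + σ • d) := by
  refine eventually_all.2 fun j => ?_
  have hz' : HasDerivAt (fun σ : ℝ => z + σ • w) w 0 := by
    simpa using ((hasDerivAt_id (0 : ℝ)).smul_const w).const_add z
  have hψ := (hasDerivAt_dot (hasDerivAt_comp_line (contDiff_rowA ha ha0 j) x d) hz').sub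
    (hasDerivAt_comp_line (contDiff_rowB hb j) x d)
  -- An active slack starts at zero with negative slope; an inactive one stays negative by
  -- continuity.
  rcases (hz j).eq_or_lt with hact | hin
  · have hslope := hψ.tendsto_slope_zero_right
    have hneg := hw j hact
    rw [slackSlope, dot_comm z] at hneg
    filter_upwards [hslope.eventually_lt_const (u := 0)
      (by simp only [zero_smul, add_zero]; linarith), self_mem_nhdsWithin] with σ hσ hσ0
    have hσ0 : 0 < σ := hσ0
    simp only [zero_add, zero_smul, add_zero, smul_eq_mul, Pi.sub_apply, hact, sub_self,
      sub_zero] at hσ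
    rw [mul_neg_iff] at hσ
    rcases hσ with h | h
    · linarith [h.2]
    · exact absurd (inv_pos.2 hσ0) (not_lt.2 h.1.le)
  · have := hψ.continuousAt.tendsto.eventually_lt_const (u := 0)
      (by simpa using hin)
    exact (this.filter_mono nhdsWithin_le_nhds).mono fun σ h => by
      simp only [Pi.sub_apply] at h
      linarith

/-- A strictly feasible linearized direction bounds the difference quotients of the radius. -/
theorem eventually_le_quotient (ha : ∀ j, ContDiff ℝ 1 (a j)) (ha0 : ∀ j x, a j x ≠ 0)
    (hb : ∀ j, ContDiff ℝ 1 (b j)) (hsol : ∀ x ∈ setA a b, (solutions a b x).Nonempty)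
    {x d : Vec n} (hx : x ∈ setA a b) {z w : Vec l × ℝ}
    (hz : z ∈ feasible a b x) (hz2 : z.2 = radius a b x)
    (hw : ∀ j, dot (rowA a j x) z = rowB b j x →
      dot (rowA a j x) w + slackSlope a b x d z j < 0) :
    ∀ᶠ σ : ℝ in 𝓝[>] 0, w.2 ≤ (radius a b (x + σ • d) - radius a b x) / σ := by
  have hline : ContinuousAt (fun σ : ℝ => x + σ • d) 0 := by fun_prop
  have hA : ∀ᶠ σ : ℝ in 𝓝[>] 0, x + σ • d ∈ setA a b :=
    (hline.eventually ((isOpen_setA ha ha0 hb).mem_nhds (by simpa using hx))).filter_mono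
      nhdsWithin_le_nhds
  filter_upwards [eventually_mem_feasible ha ha0 hb hz hw, hA, self_mem_nhdsWithin]
    with σ hσ hσA hσ0
  have hσ0 : 0 < σ := hσ0
  obtain ⟨y, hy⟩ := hsol _ hσA
  have := snd_le_radius hy hσ
  simp only [Prod.snd_add, Prod.smul_snd, smul_eq_mul, hz2] at this
  rw [le_div_iff₀ hσ0]
  linarith

/-- The difference quotients of the radius do not oscillate. -/
theorem eventually_lt_quotient_of_frequently (ha : ∀ j, ContDiff ℝ 1 (a j))
    (ha0 : ∀ j x, a j x ≠ 0) (hb : ∀ j, ContDiff ℝ 1 (b j)) {R : ℝ}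
    (hR : ∀ x, ∀ z ∈ feasible a b x, ‖z‖ ≤ R)
    (hsol : ∀ x ∈ setA a b, (solutions a b x).Nonempty) {x d : Vec n} (hx : x ∈ setA a b)
    {L L' : ℝ} (hL : L' < L)
    (hfreq : ∃ᶠ σ : ℝ in 𝓝[>] 0, L < (radius a b (x + σ • d) - radius a b x) / σ) :
    ∀ᶠ σ : ℝ in 𝓝[>] 0, L' < (radius a b (x + σ • d) - radius a b x) / σ := by
  classical
  have hline : Tendsto (fun σ : ℝ => x + σ • d) (𝓝 0) (𝓝 x) := by
    have : ContinuousAt (fun σ : ℝ => x + σ • d) 0 := by fun_prop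
    simpa [ContinuousAt] using this
  have hopen := isOpen_setA ha ha0 hb
  have hA : ∀ᶠ σ : ℝ in 𝓝[>] 0, x + σ • d ∈ setA a b :=
    (hline.eventually (hopen.mem_nhds hx)).filter_mono nhdsWithin_le_nhds
  have hcont : ContinuousAt (radius a b) x :=
    (locallyLipschitzOn_radius ha ha0 hb hR hsol).continuousOn.continuousAt (hopen.mem_nhds hx)
  obtain ⟨zt, hzt⟩ := exists_strictly_feasible ha0 hx
  choose! y hy using hsol
  have : (𝓝[>] (0 : ℝ) ⊓ 𝓟 {σ | L < (radius a b (x + σ • d) - radius a b x) / σ}).NeBot :=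
    frequently_iff_neBot.1 hfreq
  -- An ultrafilter concentrated on the steps with large quotient makes the solutions at `x + σ d`
  -- converge, without extracting sequences.
  set F := Ultrafilter.of
    (𝓝[>] (0 : ℝ) ⊓ 𝓟 {σ | L < (radius a b (x + σ • d) - radius a b x) / σ})
  have hF : (F : Filter ℝ) ≤ 𝓝[>] 0 := (Ultrafilter.of_le _).trans inf_le_left
  have hFL : ∀ᶠ σ in (F : Filter ℝ), L < (radius a b (x + σ • d) - radius a b x) / σ :=
    (Ultrafilter.of_le _).trans inf_le_right (mem_principal_self _)
  have hF0 : (F : Filter ℝ) ≤ 𝓝 0 := hF.trans nhdsWithin_le_nhds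
  have hFsol : ∀ᶠ σ in (F : Filter ℝ), y (x + σ • d) ∈ solutions a b (x + σ • d) :=
    (Eventually.filter_mono hF hA).mono fun σ hσ => hy _ hσ
  obtain ⟨z₀, -, hz₀⟩ := (isCompact_closedBall (0 : Vec l × ℝ) R).ultrafilter_le_nhds
    (F.map fun σ => y (x + σ • d)) (by
      rw [le_principal_iff]
      exact hFsol.mono fun σ hσ => by simpa using hR _ _ hσ.1)
  have hlim : Tendsto (fun σ => y (x + σ • d)) (F : Filter ℝ) (𝓝 z₀) := hz₀
  have hfeas : z₀ ∈ feasible a b x := mem_feasible_of_tendsto ha ha0 hb (hline.mono_left hF0) hlim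
    (hFsol.mono fun σ hσ => hσ.1)
  have hz2 : z₀.2 = radius a b x := by
    refine tendsto_nhds_unique ((continuous_snd.tendsto z₀).comp hlim) ?_
    refine (hcont.tendsto.comp (hline.mono_left hF0)).congr' ?_
    exact hFsol.mono fun σ hσ => radius_eq hσ
  -- The gap between `L'` and `L` leaves room for a small push towards `zt`.
  obtain ⟨s, hs, hs0⟩ : ∃ s : ℝ, L' < L + s * (zt.2 - z₀.2) ∧ 0 < s := by
    have hc : Continuous fun s : ℝ => L + s * (zt.2 - z₀.2) := by fun_prop
    exact (((hc.tendsto 0).eventually (lt_mem_nhds (by simpa using hL))).filter_mono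
      nhdsWithin_le_nhds |>.and (self_mem_nhdsWithin (a := (0 : ℝ)) (s := Ioi 0))).exists
  -- Feasibility of the solutions at `x + σ d` gives the linearized inequalities only up to a
  -- vanishing error; the push by `s` absorbs it and makes them strict.
  have hstrict : ∀ᶠ σ in (F : Filter ℝ), ∀ j, dot (rowA a j x) z₀ = rowB b j x →
      dot (rowA a j x) (σ⁻¹ • (y (x + σ • d) - z₀) + s • (zt - z₀)) +
        slackSlope a b x d z₀ j < 0 := by
    refine eventually_all.2 fun j => ?_
    by_cases hact : dot (rowA a j x) z₀ = rowB b j x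
    swap
    · exact Eventually.of_forall fun σ h => absurd h hact
    have hdA : Tendsto (fun σ : ℝ => σ⁻¹ • (rowA a j (x + σ • d) - rowA a j x)) (F : Filter ℝ)
        (𝓝 (fderiv ℝ (rowA a j) x d)) := by
      simpa using (hasDerivAt_comp_line (contDiff_rowA ha ha0 j) x
        d).tendsto_slope_zero_right.mono_left hF
    have hdB : Tendsto (fun σ : ℝ => σ⁻¹ • (rowB b j (x + σ • d) - rowB b j x)) (F : Filter ℝ)
        (𝓝 (fderiv ℝ (rowB b j) x d)) := by
      simpa using (hasDerivAt_comp_line (contDiff_rowB hb j) x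
        d).tendsto_slope_zero_right.mono_left hF
    have hdot := (continuous_dot.tendsto (fderiv ℝ (rowA a j) x d, z₀)).comp
      (hdA.prodMk_nhds hlim)
    have hneg : slackSlope a b x d z₀ j -
        (dot (fderiv ℝ (rowA a j) x d) z₀ - fderiv ℝ (rowB b j) x d) +
          s * (dot (rowA a j x) zt - rowB b j x) < 0 := by
      have := mul_neg_of_pos_of_neg hs0 (sub_neg.2 (hzt j))
      rw [slackSlope, dot_comm z₀]
      linarith
    have hev := ((tendsto_const_nhds.sub (hdot.sub hdB)).add_const _).eventually
      (gt_mem_nhds hneg)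
    filter_upwards [hev, hFsol, hF self_mem_nhdsWithin] with σ hσ hσs hσ0 _
    have hσ0 : 0 < σ := hσ0
    have h1 := mul_nonpos_of_nonneg_of_nonpos (inv_pos.2 hσ0).le (sub_nonpos.2 (hσs.1 j))
    simp only [Function.comp_apply, dot_smul_left, dot_sub_left, smul_eq_mul] at hσ
    rw [dot_add_right, dot_smul_right, dot_smul_right, dot_sub_right, dot_sub_right, hact]
    linarith
  obtain ⟨σ, hσ, hσL, hσs⟩ := (hstrict.and (hFL.and hFsol)).exists
  refine (eventually_le_quotient ha ha0 hb (fun x hx => ⟨y x, hy x hx⟩) hx hfeas hz2 hσ).mono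
    fun τ hτ => lt_of_lt_of_le ?_ hτ
  simp only [Prod.snd_add, Prod.smul_snd, Prod.snd_sub, smul_eq_mul]
  rw [radius_eq hσs, ← hz2, div_eq_inv_mul] at hσL
  linarith

/-- The Chebyshev radius has one-sided directional derivatives. -/
theorem exists_hasDirDeriv_radius (ha : ∀ j, ContDiff ℝ 1 (a j))
    (ha0 : ∀ j x, a j x ≠ 0) (hb : ∀ j, ContDiff ℝ 1 (b j)) {R : ℝ}
    (hR : ∀ x, ∀ z ∈ feasible a b x, ‖z‖ ≤ R)
    (hsol : ∀ x ∈ setA a b, (solutions a b x).Nonempty) {x : Vec n} (hx : x ∈ setA a b)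
    (d : Vec n) : ∃ ℓ : ℝ, HasDirDeriv (radius a b) x d ℓ := by
  obtain ⟨K, t, ht, hK⟩ := locallyLipschitzOn_radius ha ha0 hb hR hsol hx
  rw [(isOpen_setA ha ha0 hb).nhdsWithin_eq hx] at ht
  have hline : Tendsto (fun σ : ℝ => x + σ • d) (𝓝 0) (𝓝 x) := by
    have : ContinuousAt (fun σ : ℝ => x + σ • d) 0 := by fun_prop
    simpa [ContinuousAt] using this
  have hbd : ∀ᶠ σ : ℝ in 𝓝[>] 0,
      |(radius a b (x + σ • d) - radius a b x) / σ| ≤ K * ‖d‖ := by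
    filter_upwards [(hline.eventually ht).filter_mono nhdsWithin_le_nhds, self_mem_nhdsWithin]
      with σ hσ hσ0
    have hσ0 : 0 < σ := hσ0
    have h := hK.dist_le_mul _ hσ _ (mem_of_mem_nhds ht)
    rw [Real.dist_eq, dist_eq_norm, add_sub_cancel_left, norm_smul, Real.norm_eq_abs,
      abs_of_pos hσ0] at h
    rw [abs_div, abs_of_pos hσ0, div_le_iff₀ hσ0]
    linarith
  -- The Lipschitz bound keeps the quotients bounded, and once they exceed `L` frequently they
  -- eventually stay above any `L' < L`.
  refine tendsto_of_no_upcrossings dense_univ (fun L' _ L _ hL h => ?_)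
    (isBoundedUnder_of_eventually_le (a := K * ‖d‖) (hbd.mono fun σ h => (abs_le.1 h).2))
    (isBoundedUnder_of_eventually_ge (a := -(K * ‖d‖)) (hbd.mono fun σ h => (abs_le.1 h).1))
  have hev := eventually_lt_quotient_of_frequently ha ha0 hb hR hsol hx hL h.2
  obtain ⟨σ, h1, h2⟩ := (h.1.and_eventually hev).exists
  exact lt_asymm h1 h2

/-- A lower bound of the Lagrangian derivative over the multipliers is a lower bound of the
directional derivative of the radius. -/
theorem le_of_hasDirDeriv_radius (ha : ∀ j, ContDiff ℝ 1 (a j))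
    (ha0 : ∀ j x, a j x ≠ 0) (hb : ∀ j, ContDiff ℝ 1 (b j))
    (hsol : ∀ x ∈ setA a b, (solutions a b x).Nonempty) {x d : Vec n} (hx : x ∈ setA a b)
    {z : Vec l × ℝ} (hz : z ∈ solutions a b x) {κ : ℝ}
    (hκ : ∀ μ ∈ multipliers a b z x, κ ≤ -lagrangianDx a b z x μ d) {ℓ : ℝ}
    (hℓ : HasDirDeriv (radius a b) x d ℓ) : κ ≤ ℓ := by
  refine le_of_forall_lt fun κ' hκ' => ?_
  obtain ⟨κ'', h1, h2⟩ := exists_between hκ'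
  refine lt_of_lt_of_le h1 ?_
  obtain ⟨zt, hzt⟩ := exists_strictly_feasible ha0 hx
  let dotL : Vec l × ℝ → (Vec l × ℝ) →ₗ[ℝ] ℝ := fun p =>
    { toFun := dot p
      map_add' := dot_add_right p
      map_smul' := fun t w => dot_smul_right p t w }
  -- The index `none` carries the requirement `w.2 > κ''`; the others carry the linearized active
  -- constraints.
  let ℒ : Option (activeSet a b z x) → (Vec l × ℝ) →ₗ[ℝ] ℝ := fun o =>
    o.elim (dotL (costVec l)) fun j => dotL (rowA a (j : Fin (N + 1)) x)
  let c : Option (activeSet a b z x) → ℝ := fun o =>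
    o.elim κ'' fun j => slackSlope a b x d z j
  have hactive : ∀ j : activeSet a b z x,
      dot (rowA a (j : Fin (N + 1)) x) z = rowB b (j : Fin (N + 1)) x := fun j =>
    (Finset.mem_filter.1 j.2).2
  rcases exists_forall_neg_or_exists_nonneg_combination ℒ c with ⟨w, hw⟩ | ⟨lam, h0, hne, hge⟩
  · have hev := eventually_le_quotient ha ha0 hb hsol hx hz.1 (radius_eq hz).symm (w := w)
      (fun j hj => hw (some ⟨j, Finset.mem_filter.2 ⟨Finset.mem_univ j, hj⟩⟩))
    have hw2 : dot (costVec l) w + κ'' < 0 := hw none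
    rw [dot_costVec] at hw2
    exact ge_of_tendsto hℓ (hev.mono fun σ h => by linarith)
  · exfalso
    have hge' : ∀ w, 0 ≤ lam none * (-w.2 + κ'') +
        ∑ j : activeSet a b z x, lam (some j) *
          (dot (rowA a (j : Fin (N + 1)) x) w + slackSlope a b x d z j) := by
      intro w
      have := hge w
      rw [Fintype.sum_option] at this
      rw [← dot_costVec]
      exact this
    set P : Vec l × ℝ :=
      lam none • costVec l + ∑ j : activeSet a b z x, lam (some j) • rowA a (j : Fin (N + 1)) x
      with hP
    set q : ℝ := lam none * κ'' +
      ∑ j : activeSet a b z x, lam (some j) * slackSlope a b x d z j with hq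
    have haff : ∀ w, 0 ≤ dot P w + q := by
      intro w
      have := hge' w
      simp only [mul_add, Finset.sum_add_distrib] at this
      simp only [hP, hq, dot_add_left, dot_smul_left, dot_sum_left, dot_costVec]
      linarith
    -- An affine function bounded below has zero linear part.
    have hP0 : P = 0 := by
      refine eq_zero_of_dot_eq_zero fun w => ?_
      by_contra hne0
      have := haff ((-(q + 1) / dot P w) • w)
      rw [dot_smul_right, div_mul_cancel₀ _ hne0] at this
      linarith
    have hq0 : 0 ≤ q := by simpa [hP0, dot_zero_left] using haff 0
    -- Slater's condition excludes zero weight on the objective: all active rows are negative on `zt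
    -- - z`, so the remaining weights would vanish too.
    rcases (h0 none).eq_or_lt with hn | hpos
    · have hsum : ∑ j : activeSet a b z x, lam (some j) *
          dot (rowA a (j : Fin (N + 1)) x) (zt - z) = 0 := by
        have : dot P (zt - z) = 0 := by rw [hP0, dot_zero_left]
        simpa [hP, ← hn, dot_add_left, dot_sum_left, dot_smul_left, dot_zero_left] using this
      have hneg : ∀ j : activeSet a b z x,
          dot (rowA a (j : Fin (N + 1)) x) (zt - z) < 0 := fun j => by
        rw [dot_sub_right, hactive j]
        exact sub_neg.2 (hzt j)
      have hall := (Finset.sum_eq_zero_iff_of_nonpos (fun j _ =>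
        mul_nonpos_of_nonneg_of_nonpos (h0 (some j)) (hneg j).le)).1 hsum
      obtain ⟨i, hi⟩ := hne
      rcases i with _ | j
      · exact hi hn.symm
      · exact (mul_ne_zero hi (hneg j).ne) (hall j (Finset.mem_univ j))
    -- Normalizing the objective weight to one gives a multiplier with `-∂ₓL ≤ κ'' < κ`, against the
    -- assumed bound.
    · have hμ : (fun j => lam (some j) / lam none) ∈ multipliers a b z x := by
        refine ⟨?_, fun j => div_nonneg (h0 _) hpos.le⟩
        have h3 : ∑ j : activeSet a b z x, lam (some j) • rowA a (j : Fin (N + 1)) x =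
            -(lam none • costVec l) := by
          rw [eq_neg_iff_add_eq_zero, add_comm]
          exact hP0
        simp only [div_eq_inv_mul, mul_smul]
        rw [← Finset.smul_sum, h3, smul_neg, smul_smul, inv_mul_cancel₀ hpos.ne', one_smul]
      have h4 := hκ _ hμ
      have h5 : lam none * lagrangianDx a b z x (fun j => lam (some j) / lam none) d =
          ∑ j : activeSet a b z x, lam (some j) * slackSlope a b x d z j := by
        rw [lagrangianDx, Finset.mul_sum]
        refine Finset.sum_congr rfl fun j _ => ?_
        rw [slackSlope, ← mul_assoc, mul_div_cancel₀ _ hpos.ne']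
      rw [hq, ← h5, ← mul_add] at hq0
      have := nonneg_of_mul_nonneg_right hq0 hpos
      linarith

end directional

/-! ### The multiplier polytope -/

section vertices

variable {n l N : ℕ} {a : Fin N → Vec n → Vec l} {b : Fin N → Vec n → ℝ}

theorem finite_vertices (z : Vec l × ℝ) (x : Vec n) : (vertices a b z x).Finite :=
  finite_extremePoints_nonneg_combinations _ _

theorem convex_multipliers (z : Vec l × ℝ) (x : Vec n) : Convex ℝ (multipliers a b z x) := by
  intro μ hμ ν hν s t hs ht hst
  refine ⟨?_, fun j => ?_⟩
  · simp only [Pi.add_apply, Pi.smul_apply, smul_eq_mul, add_smul, mul_smul,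
      Finset.sum_add_distrib, ← Finset.smul_sum, hμ.1, hν.1]
    rw [← add_smul, hst, one_smul]
  · have h1 := mul_nonneg hs (hμ.2 j)
    have h2 := mul_nonneg ht (hν.2 j)
    simpa using add_nonneg h1 h2

/-- Pairing the multiplier equation with `z - zt` gives a sum of nonnegative terms with fixed total
and positive coefficients on the `μ j`, which boxes in each coordinate. -/
theorem isCompact_multipliers (ha0 : ∀ j x, a j x ≠ 0) {x : Vec n} (hx : x ∈ setA a b)
    (z : Vec l × ℝ) : IsCompact (multipliers a b z x) := by
  obtain ⟨zt, hzt⟩ := exists_strictly_feasible ha0 hx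
  have hpos : ∀ j : activeSet a b z x, 0 < dot (rowA a (j : Fin (N + 1)) x) (z - zt) := fun j => by
    rw [dot_sub_right, (Finset.mem_filter.1 j.2).2]
    exact sub_pos.2 (hzt j)
  have hclosed : IsClosed (multipliers a b z x) := by
    have h1 : IsClosed {μ : activeSet a b z x → ℝ |
        ∑ j, μ j • rowA a (j : Fin (N + 1)) x = -costVec l} :=
      isClosed_eq (by fun_prop) continuous_const
    have h2 : IsClosed {μ : activeSet a b z x → ℝ | ∀ j, 0 ≤ μ j} := by
      have : {μ : activeSet a b z x → ℝ | ∀ j, 0 ≤ μ j} = Ici 0 := rfl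
      rw [this]
      exact isClosed_Ici
    exact h1.inter h2
  refine (isCompact_Icc (a := 0) (b := fun j : activeSet a b z x =>
    (z.2 - zt.2) / dot (rowA a (j : Fin (N + 1)) x) (z - zt))).of_isClosed_subset hclosed ?_
  intro μ hμ
  refine ⟨hμ.2, fun j => ?_⟩
  rw [le_div_iff₀ (hpos j)]
  have hsum : ∑ j : activeSet a b z x, μ j * dot (rowA a (j : Fin (N + 1)) x) (z - zt) =
      z.2 - zt.2 := by
    have := congrArg (fun p => dot p (z - zt)) hμ.1
    simpa only [dot_sum_left, dot_smul_left, dot_neg_costVec, Prod.snd_sub] using this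
  rw [← hsum]
  exact Finset.single_le_sum
    (f := fun j : activeSet a b z x => μ j * dot (rowA a (j : Fin (N + 1)) x) (z - zt))
    (fun i _ => mul_nonneg (hμ.2 i) (hpos i).le) (Finset.mem_univ j)

/-- Krein–Milman; the closure is superfluous because the hull of finitely many points is compact. -/
theorem multipliers_eq_convexHull (ha0 : ∀ j x, a j x ≠ 0) {x : Vec n} (hx : x ∈ setA a b)
    (z : Vec l × ℝ) : multipliers a b z x = convexHull ℝ (vertices a b z x) := by
  rw [← ((finite_vertices z x).isCompact_convexHull ℝ).isClosed.closure_eq]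
  exact (closure_convexHull_extremePoints (isCompact_multipliers ha0 hx z)
    (convex_multipliers z x)).symm

theorem convex_setOf_le_neg_lagrangianDx (z : Vec l × ℝ) (x v : Vec n) (κ : ℝ) :
    Convex ℝ {μ : activeSet a b z x → ℝ | κ ≤ -lagrangianDx a b z x μ v} := by
  intro μ hμ ν hν s t hs ht hst
  have hμ : κ ≤ -lagrangianDx a b z x μ v := hμ
  have hν : κ ≤ -lagrangianDx a b z x ν v := hν
  have hlin : lagrangianDx a b z x (s • μ + t • ν) v =
      s * lagrangianDx a b z x μ v + t * lagrangianDx a b z x ν v := by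
    simp only [lagrangianDx, Pi.add_apply, Pi.smul_apply, smul_eq_mul, Finset.mul_sum,
      ← Finset.sum_add_distrib]
    exact Finset.sum_congr rfl fun j _ => by ring
  change κ ≤ -lagrangianDx a b z x (s • μ + t • ν) v
  rw [hlin]
  have h1 := mul_le_mul_of_nonneg_left hμ hs
  have h2 := mul_le_mul_of_nonneg_left hν ht
  have h3 : κ = s * κ + t * κ := by rw [← add_mul, hst, one_mul]
  linarith

end vertices

/-! ### The barrier function `h_r` -/

section barrier

variable {n l N : ℕ} {a : Fin N → Vec n → Vec l} {b : Fin N → Vec n → ℝ}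

theorem hasDirDeriv_hr_iff {ε₀ : ℝ} {x d : Vec n} {ℓ : ℝ} :
    HasDirDeriv (hr a b ε₀) x d ℓ ↔ HasDirDeriv (radius a b) x d ℓ := by
  simp only [HasDirDeriv, hr, sub_sub_sub_cancel_right]

theorem locallyLipschitzOn_hr {s : Set (Vec n)} (h : LocallyLipschitzOn s (radius a b)) (ε₀ : ℝ) :
    LocallyLipschitzOn s (hr a b ε₀) := by
  intro x hx
  obtain ⟨K, t, ht, hK⟩ := h hx
  refine ⟨K, t, ht, fun y hy y' hy' => ?_⟩
  simpa [hr, edist_dist, Real.dist_eq] using hK hy hy'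

/-- Closedness holds in the whole space, not just relative to `setA a b`: limits of solutions keep
radius at least `ε₀ > 0`, so the limit polytope still contains a ball. -/
theorem isClosed_safeSet (ha : ∀ j, ContDiff ℝ 1 (a j))
    (ha0 : ∀ j x, a j x ≠ 0) (hb : ∀ j, ContDiff ℝ 1 (b j)) {R : ℝ}
    (hR : ∀ x, ∀ z ∈ feasible a b x, ‖z‖ ≤ R)
    (hsol : ∀ x ∈ setA a b, (solutions a b x).Nonempty) {ε₀ : ℝ} (hε₀ : 0 < ε₀) :
    IsClosed (safeSet a b ε₀) := by
  choose! y hy using hsol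
  rw [isClosed_iff_ultrafilter]
  intro x F hF hmem
  have hev : ∀ᶠ p in (F : Filter (Vec n)), p ∈ safeSet a b ε₀ := hmem
  obtain ⟨z₀, -, hz₀⟩ := (isCompact_closedBall (0 : Vec l × ℝ) R).ultrafilter_le_nhds
    (F.map y) (by
      rw [le_principal_iff]
      exact hev.mono fun p hp => by simpa using hR _ _ (hy p hp.1).1)
  have hlim : Tendsto y F (𝓝 z₀) := hz₀
  have hfeas : z₀ ∈ feasible a b x := mem_feasible_of_tendsto ha ha0 hb (y := id) hF hlim
    (hev.mono fun p hp => (hy p hp.1).1)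
  have hge : ε₀ ≤ z₀.2 := ge_of_tendsto ((continuous_snd.tendsto z₀).comp hlim)
    (hev.mono fun p hp => by
      have := hp.2
      rw [hr, radius_eq (hy p hp.1)] at this
      exact sub_nonneg.1 this)
  have hxA := mem_setA_of_mem_feasible hfeas (hε₀.trans_le hge)
  refine ⟨hxA, ?_⟩
  have := snd_le_radius (hy x hxA) hfeas
  rw [hr]
  linarith

theorem isNBFCandidate_hr (ha : ∀ j, ContDiff ℝ 1 (a j))
    (ha0 : ∀ j x, a j x ≠ 0) (hb : ∀ j, ContDiff ℝ 1 (b j)) {R : ℝ}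
    (hR : ∀ x, ∀ z ∈ feasible a b x, ‖z‖ ≤ R)
    (hsol : ∀ x ∈ setA a b, (solutions a b x).Nonempty) {ε₀ : ℝ} (hε₀ : 0 < ε₀)
    (hne : (safeSet a b ε₀).Nonempty) (hperf : Preperfect (safeSet a b ε₀))
    (hzero : ∀ x ∈ interior (safeSet a b ε₀), hr a b ε₀ x ≠ 0) :
    IsNBFCandidate (setA a b) (hr a b ε₀) (safeSet a b ε₀) := by
  have hlip := locallyLipschitzOn_hr (locallyLipschitzOn_radius ha ha0 hb hR hsol) ε₀
  have hclosed := isClosed_safeSet ha ha0 hb hR hsol hε₀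
  refine ⟨hne, hclosed, hperf, fun x hx => hx.1, hlip, fun x hx => ?_, fun x hx => ?_,
    fun x hx => ?_⟩
  · rw [hclosed.frontier_eq] at hx
    refine le_antisymm ?_ hx.1.2
    by_contra! hpos
    refine hx.2 (mem_interior_iff_mem_nhds.2 ?_)
    have hA := (isOpen_setA ha ha0 hb).mem_nhds hx.1.1
    filter_upwards [hA, (hlip.continuousOn.continuousAt hA).eventually (lt_mem_nhds hpos)]
      with p hp1 hp2
    exact ⟨hp1, hp2.le⟩
  · exact lt_of_le_of_ne (interior_subset hx).2 (hzero x hx).symm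
  · by_contra! h
    exact hx.2 ⟨hx.1, h⟩

theorem ncbfCondition_hr {m : ℕ} (f : Vec n → Vec n) (g : Vec n → Vec m →L[ℝ] Vec n)
    (Ψ : Vec n → Set (Vec m)) (ha : ∀ j, ContDiff ℝ 1 (a j))
    (ha0 : ∀ j x, a j x ≠ 0) (hb : ∀ j, ContDiff ℝ 1 (b j)) {R : ℝ}
    (hR : ∀ x, ∀ z ∈ feasible a b x, ‖z‖ ≤ R) (ε₀ : ℝ) {zs : Vec n → Vec l × ℝ}
    (hzs : ∀ x ∈ setA a b, zs x ∈ solutions a b x) {α εb : ℝ} (hα : 0 < α) (hεb : 0 < εb)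
    (hu : ∀ x ∈ superlevel a b ε₀ εb, ∃ u ∈ Ψ x, ∀ μ ∈ vertices a b (zs x) x,
      -α * hr a b ε₀ x ≤ Gam a b f g (zs x) x μ u) :
    NCBFCondition f g Ψ (setA a b) (hr a b ε₀) (safeSet a b ε₀) := by
  have hsol : ∀ x ∈ setA a b, (solutions a b x).Nonempty := fun x hx => ⟨zs x, hzs x hx⟩
  have hder : ∀ x ∈ setA a b, ∀ d : Vec n, ∃ ℓ : ℝ, HasDirDeriv (hr a b ε₀) x d ℓ := by
    intro x hx d
    obtain ⟨ℓ, hℓ⟩ := exists_hasDirDeriv_radius ha ha0 hb hR hsol hx d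
    exact ⟨ℓ, hasDirDeriv_hr_iff.2 hℓ⟩
  have hcont :=
    (locallyLipschitzOn_hr (locallyLipschitzOn_radius ha ha0 hb hR hsol) ε₀).continuousOn
  -- The class-K function is linear, and `D` is the part of the domain where `h_r > -εb`, open by
  -- continuity and inside the region where a control is supplied.
  refine ⟨hder, fun s => α * s, setA a b ∩ hr a b ε₀ ⁻¹' Ioi (-εb),
    ⟨by fun_prop, fun s t h => mul_lt_mul_of_pos_left h hα, mul_zero α⟩,
    hcont.isOpen_inter_preimage (isOpen_setA ha ha0 hb) isOpen_Ioi,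
    fun x hx => ⟨hx.1, (neg_lt_zero.2 hεb).trans_le hx.2⟩, inter_subset_left, ?_⟩
  intro x ⟨hxA, hxε⟩
  obtain ⟨u, huΨ, hΓ⟩ := hu x ⟨hxA, (mem_Ioi.1 hxε).le⟩
  refine le_iSup₂_of_le u huΨ (EReal.coe_le_coe_iff.2 ?_)
  obtain ⟨ℓ, hℓ⟩ := hder x hxA (f x + g x u)
  have hlim : dirDeriv (hr a b ε₀) x (f x + g x u) = ℓ := Tendsto.limUnder_eq hℓ
  rw [hlim]
  refine le_of_hasDirDeriv_radius ha ha0 hb hsol hxA (hzs x hxA) (fun μ hμ => ?_)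
    (hasDirDeriv_hr_iff.1 hℓ)
  rw [multipliers_eq_convexHull ha0 hxA] at hμ
  -- The bound is affine in the multiplier, so it passes from the vertices to their hull.
  refine convexHull_min (fun ν hν => ?_)
    (convex_setOf_le_neg_lagrangianDx (zs x) x (f x + g x u) (-(α * hr a b ε₀ x))) hμ
  have := hΓ ν hν
  rw [neg_mul] at this
  exact this

end barrier

end PVM

theorem corollary1 {n m l N N' : ℕ}
    (f : PVM.Vec n → PVM.Vec n) (g : PVM.Vec n → PVM.Vec m →L[ℝ] PVM.Vec n)
    (hf : LocallyLipschitz f) (hg : LocallyLipschitz g)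
    (a : Fin N → PVM.Vec n → PVM.Vec l) (b : Fin N → PVM.Vec n → ℝ)
    (ha : ∀ j, ContDiff ℝ 1 (a j)) (hb : ∀ j, ContDiff ℝ 1 (b j))
    (a' : Fin N' → PVM.Vec n → PVM.Vec m) (b' : Fin N' → PVM.Vec n → ℝ)
    (ha' : ∀ i, ContDiff ℝ 1 (a' i)) (hb' : ∀ i, ContDiff ℝ 1 (b' i))
    (hΨ : ∀ x, (PVM.polytope a' b' x).Nonempty)
    (ha0 : ∀ j x, a j x ≠ 0)
    (hΦ : ∃ Dy : Set (PVM.Vec l), IsCompact Dy ∧ ∀ x, PVM.polytope a b x ⊆ Dy)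
    (ε₀ : ℝ) (hε₀ : 0 < ε₀)
    (zs : PVM.Vec n → PVM.Vec l × ℝ)
    (hzs : ∀ x ∈ PVM.setA a b, zs x ∈ PVM.solutions a b x) :
    (∀ x ∈ PVM.setA a b, (PVM.vertices a b (zs x) x).Finite ∧
      PVM.multipliers a b (zs x) x = convexHull ℝ (PVM.vertices a b (zs x) x)) ∧
    ((∃ α εb : ℝ, 0 < α ∧ 0 < εb ∧ ∀ x ∈ PVM.superlevel a b ε₀ εb,
        ∃ u ∈ PVM.polytope a' b' x, ∀ μ ∈ PVM.vertices a b (zs x) x,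
          -α * PVM.hr a b ε₀ x ≤ PVM.Gam a b f g (zs x) x μ u) →
      PVM.NCBFCondition f g (PVM.polytope a' b') (PVM.setA a b) (PVM.hr a b ε₀)
        (PVM.safeSet a b ε₀) ∧
      ((PVM.safeSet a b ε₀).Nonempty → Preperfect (PVM.safeSet a b ε₀) →
        (∀ x ∈ interior (PVM.safeSet a b ε₀), PVM.hr a b ε₀ x ≠ 0) →
        PVM.IsNCBF f g (PVM.polytope a' b') (PVM.setA a b) (PVM.hr a b ε₀)
          (PVM.safeSet a b ε₀))) := by
  refine ⟨fun x hx => ⟨PVM.finite_vertices _ _, PVM.multipliers_eq_convexHull ha0 hx _⟩, ?_⟩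
  rintro ⟨α, εb, hα, hεb, hu⟩
  have hsol : ∀ x ∈ PVM.setA a b, (PVM.solutions a b x).Nonempty := fun x hx => ⟨zs x, hzs x hx⟩
  obtain ⟨R, hR⟩ := PVM.exists_bound_of_mem_feasible ha0 hΦ (PVM.pos_of_solutions_nonempty hsol)
  have hcond := PVM.ncbfCondition_hr f g (PVM.polytope a' b') ha ha0 hb hR ε₀ hzs hα hεb hu
  exact ⟨hcond, fun hne hperf hzero =>
    ⟨PVM.isNBFCandidate_hr ha ha0 hb hR hsol hε₀ hne hperf hzero, hcond⟩⟩
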